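/- Let $\Sigma=\{a,b\}$. An $\mathrm{NCM}(1,1)$ over $\Sigma$ is a nondeterministic one-way machine with one counter, a finite state set and a right input end-marker, which can test its (nonnegative, initially zero) counter for zero, change it by $-1$, $0$ or $+1$ in a step, and whose counter makes at most one reversal in every computation (once it has been decremented, it is never incremented again). It accepts $w\in\Sigma^*$ if some computation on $w$ reaches a final state when exactly the end-marker is left to be read. DFAs may have partial transition functions. For languages $L_1,L_2\subseteq\Sigma^*$, the shuffle $L_1 \mathbin{\sqcup\!\sqcup} L_2$ is the set of all words $u_1v_1u_2v_2\cdots u_nv_n$ with $u_i,v_i\in\Sigma^*$, $u_1\cdots u_n\in L_1$ and $v_1\cdots v_n\in L_2$. Proposition. (1) It is undecidable, given a one-state DFA $M_1$ accepting $a^*$, a one-state DFA $M_2$ accepting $b^*$, and an $\mathrm{NCM}(1,1)$ $M_3$ over $\Sigma$, whether $L(M_1) \mathbin{\sqcup\!\sqcup} L(M_2)\subseteq L(M_3)$. That is, no algorithm halts with the correct answer on all such triples $(M_1,M_2,M_3)$. (2) For all such $M_1,M_2,M_3$, $L(M_1) \mathbin{\sqcup\!\sqcup} L(M_2)\subseteq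 L(M_3)$ holds if and only if $L(M_3)=\Sigma^*$. (3) It is undecidable, given an $\mathrm{NCM}(1,1)$ $M_3$ over $\Sigma$, whether $L(M_3)=\Sigma^*$. -/

import Mathlib

open scoped Computability

/-! ### Words and shuffle -/

/-- The two-letter alphabet `{a, b}`. -/
inductive Letter : Type
  | a
  | b
  deriving DecidableEq

/-- The letters, identified with the booleans. -/
def Letter.equivBool : Letter ≃ Bool where
  toFun x := match x with
    | .a => false
    | .b => true
  invFun x := match x with
    | false => .a
    | true => .b
  left_inv x := by cases x <;> rfl
  right_inv x := by cases x <;> rfl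

instance : Primcodable Letter := Primcodable.ofEquiv Bool Letter.equivBool

/-- The shuffle of two words: all words `u₁ v₁ u₂ v₂ ⋯ uₙ vₙ` with `u = u₁ ⋯ uₙ` and
`v = v₁ ⋯ vₙ`; the list `l` consists of the pairs `(uᵢ, vᵢ)`. -/
def wordShuffle {α : Type*} (u v : List α) : Language α :=
  {w | ∃ l : List (List α × List α),
    u = (l.map Prod.fst).flatten ∧ v = (l.map Prod.snd).flatten ∧
      w = (l.map fun p => p.1 ++ p.2).flatten}

/-- The shuffle of two languages: the union of the shuffles of their words. -/
def languageShuffle {α : Type*} (L₁ L₂ : Language α) : Language α :=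
  {w | ∃ u ∈ L₁, ∃ v ∈ L₂, w ∈ wordShuffle u v}

infixl:70 " ⧢ " => languageShuffle

/-! ### Deterministic finite automata, as finite data -/

/-- The finite description of a finite automaton over `α` with state set
`{0, …, numStates - 1}`, transitions being listed as triples (source, letter, target). -/
structure FiniteAutomaton (α : Type) where
  numStates : ℕ
  start : ℕ
  final : List ℕ
  trans : List (ℕ × α × ℕ)

namespace FiniteAutomaton

variable {α : Type}

/-- A description as a tuple. -/
def equivTuple : FiniteAutomaton α ≃ ℕ × ℕ × List ℕ × List (ℕ × α × ℕ) where
  toFun M := (M.numStates, M.start, M.final, M.trans)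
  invFun x := ⟨x.1, x.2.1, x.2.2.1, x.2.2.2⟩
  left_inv _ := rfl
  right_inv _ := rfl

instance [Primcodable α] : Primcodable (FiniteAutomaton α) :=
  Primcodable.ofEquiv _ equivTuple

/-- `M` is a deterministic finite automaton: the start state, the final states and the states in
transitions are states of `M`, and each state has at most one transition for each letter (the
transition function may be partial). -/
structure IsDFA (M : FiniteAutomaton α) : Prop where
  start_lt : M.start < M.numStates
  final_lt : ∀ q ∈ M.final, q < M.numStates
  trans_lt : ∀ t ∈ M.trans, t.1 < M.numStates ∧ t.2.2 < M.numStates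
  deterministic : ∀ q x p p', (q, x, p) ∈ M.trans → (q, x, p') ∈ M.trans → p = p'

/-- The automaton described by `M`. -/
def toNFA (M : FiniteAutomaton α) : NFA α (Fin M.numStates) where
  step q x := {p | ((q : ℕ), x, (p : ℕ)) ∈ M.trans}
  start := {q | (q : ℕ) = M.start}
  accept := {q | (q : ℕ) ∈ M.final}

/-- The language accepted by `M`. -/
def language (M : FiniteAutomaton α) : Language α := M.toNFA.accepts

end FiniteAutomaton

/-! ### One-way multicounter machines, as finite data -/

instance : Primcodable SignType := Primcodable.ofEquiv (Fin 3) SignType.fin3Equiv.toEquiv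

/-- One element of the transition relation of a one-way `k`-counter machine over `α`. The symbol
read is `some x` for a letter `x` and `none` for the right end-marker; `positive i` tells whether
counter `i` has to be positive or zero; `advance` tells whether the input head moves right
(`true`) or stays (`false`); `delta i` is the change of counter `i`. -/
structure CounterTransition (k : ℕ) (α : Type) where
  source : ℕ
  read : Option α
  positive : Fin k → Bool
  target : ℕ
  advance : Bool
  delta : Fin k → SignType

/-- The finite description of a nondeterministic one-way `k`-counter machine over `α` with state
set `{0, …, numStates - 1}`. -/
structure CounterMachine (k : ℕ) (α : Type) where
  numStates : ℕ
  start : ℕ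
  final : List ℕ
  trans : List (CounterTransition k α)

/-- A transition as a tuple. -/
def CounterTransition.equivTuple {k : ℕ} {α : Type} : CounterTransition k α ≃
    ℕ × Option α × (Fin k → Bool) × ℕ × Bool × (Fin k → SignType) where
  toFun t := (t.source, t.read, t.positive, t.target, t.advance, t.delta)
  invFun x := ⟨x.1, x.2.1, x.2.2.1, x.2.2.2.1, x.2.2.2.2.1, x.2.2.2.2.2⟩
  left_inv _ := rfl
  right_inv _ := rfl

instance {k : ℕ} {α : Type} [Primcodable α] : Primcodable (CounterTransition k α) :=
  Primcodable.ofEquiv _ CounterTransition.equivTuple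

/-- A configuration: state, remaining input (with the end-marker `none`), counter contents. -/
structure CounterConfig (k : ℕ) (α : Type) where
  state : ℕ
  input : List (Option α)
  counters : Fin k → ℕ

/-- The number of reversals in a sequence of changes of one counter: the number of sign changes
after the zeros have been removed. -/
def counterReversals (ds : List SignType) : ℕ :=
  ((ds.filter fun d => d ≠ 0).destutter (· ≠ ·)).length - 1

namespace CounterMachine

variable {k : ℕ} {α : Type}

/-- A machine description as a tuple. -/
def equivTuple : CounterMachine k α ≃ ℕ × ℕ × List ℕ × List (CounterTransition k α) where
  toFun M := (M.numStates, M.start, M.final, M.trans)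
  invFun x := ⟨x.1, x.2.1, x.2.2.1, x.2.2.2⟩
  left_inv _ := rfl
  right_inv _ := rfl

instance [Primcodable α] : Primcodable (CounterMachine k α) :=
  Primcodable.ofEquiv _ equivTuple

/-- The description is one of a counter machine: the start state, the final states and the states
in transitions are states of `M`, and no transition decrements a counter that it tests to be
zero. -/
structure WellFormed (M : CounterMachine k α) : Prop where
  start_lt : M.start < M.numStates
  final_lt : ∀ q ∈ M.final, q < M.numStates
  trans_lt : ∀ t ∈ M.trans, t.source < M.numStates ∧ t.target < M.numStates
  delta_nonneg : ∀ t ∈ M.trans, ∀ i, t.positive i = false → 0 ≤ t.delta i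

/-- `M.Step c d c'`: the configuration `c` derives `c'` in one step that changes the counters
by `d`. -/
def Step (M : CounterMachine k α) (c : CounterConfig k α) (d : Fin k → SignType)
    (c' : CounterConfig k α) : Prop :=
  ∃ t ∈ M.trans, ∃ w : List (Option α),
    c.state = t.source ∧ c.input = t.read :: w ∧
    (∀ i, t.positive i = true ↔ c.counters i ≠ 0) ∧
    d = t.delta ∧
    c'.state = t.target ∧ c'.input = (if t.advance = true then w else t.read :: w) ∧
    ∀ i, (c'.counters i : ℤ) = (c.counters i : ℤ) + (d i : ℤ)

/-- `M.Run c ds c'`: there is a finite computation from `c` to `c'` whose successive steps change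
the counters by the entries of `ds`. -/
inductive Run (M : CounterMachine k α) :
    CounterConfig k α → List (Fin k → SignType) → CounterConfig k α → Prop
  | nil (c : CounterConfig k α) : Run M c [] c
  | cons {c c' c'' : CounterConfig k α} {d : Fin k → SignType} {ds : List (Fin k → SignType)} :
      M.Step c d c' → Run M c' ds c'' → Run M c (d :: ds) c''

/-- The initial configuration on the input word `w`, which is followed by the end-marker. -/
def init (M : CounterMachine k α) (w : List α) : CounterConfig k α :=
  ⟨M.start, w.map some ++ [none], fun _ => 0⟩

/-- The language accepted by `M`: the words on which some computation reaches a final state with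
exactly the end-marker left, with arbitrary counter contents. -/
def language (M : CounterMachine k α) : Language α :=
  {w | ∃ ds, ∃ q ∈ M.final, ∃ c, M.Run (M.init w) ds ⟨q, [none], c⟩}

/-- Every counter makes at most `r` reversals in every computation, on every input word. -/
def ReversalBounded (M : CounterMachine k α) (r : ℕ) : Prop :=
  ∀ w ds c, M.Run (M.init w) ds c → ∀ i, counterReversals (ds.map fun d => d i) ≤ r

end CounterMachine

/-- `M` is an `NCM(k, r)`: a nondeterministic one-way `k`-counter machine all of whose counters
are `r`-reversal-bounded. -/
def IsNCM {α : Type} (k r : ℕ) (M : CounterMachine k α) : Prop :=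
  M.WellFormed ∧ M.ReversalBounded r

/-! ### Decision problems -/

/-- The problem "given an instance `x` with `P x`, does `p x` hold?" is decidable: some algorithm
halts on every instance that satisfies `P` and answers correctly there. It may do anything,
including not halting, on other inputs. -/
def DecidableGiven {X : Type} [Primcodable X] (P p : X → Prop) : Prop :=
  ∃ f : X →. Bool, Partrec f ∧ ∀ x, P x → ∃ ans ∈ f x, (ans = true ↔ p x)

/-- `(M₁, M₂, M₃)` consists of a one-state DFA accepting `a*`, a one-state DFA accepting `b*`, and
an `NCM(1, 1)`, all over `{a, b}`. -/
def IsShuffleInstance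
    (x : FiniteAutomaton Letter × FiniteAutomaton Letter × CounterMachine 1 Letter) : Prop :=
  (x.1.IsDFA ∧ x.1.numStates = 1 ∧ x.1.language = ({[Letter.a]} : Language Letter)∗) ∧
  (x.2.1.IsDFA ∧ x.2.1.numStates = 1 ∧ x.2.1.language = ({[Letter.b]} : Language Letter)∗) ∧
  IsNCM 1 1 x.2.2

/-!
The undecidability of universality is proved by the method of invalid computations. Fix a Turing
machine `M` whose halting problem is undecidable (`exists_machine_undecidable`). For each input, a
machine with one counter and one reversal is constructed that accepts the words which do not encode
a halting computation of `M` on that input; it accepts all words just if `M` does not halt.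

A configuration consists of a state, a scanned symbol and two half-tapes. Reading a half-tape as a
number in the base given by the number of symbols, the symbol next to the head being the last
digit, a move multiplies one of the two numbers by the base, and adds a digit, while it divides the
other one by the base. A configuration is therefore encoded by two numbers `S * v + c`, one for each
half-tape `v`, where `c < S` encodes the state, the symbol and the side (`TapeCode.code`). A
computation is the sequence `x₀, x₁, x₂, …` of these numbers, written as the word
`b a^x₀ b a^x₁ b a^x₂ b ⋯`. Such a sequence is one of successive configurations if each window
`x, y, z` of three consecutive numbers satisfies a condition on residues modulo a fixed number, and an
equation `x / d = z / d'`, where `d` and `d'` depend on residues, too (`TapeCode.Fits`,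
`TapeCode.exists_good_iff`).

The failure of such a condition can be guessed and verified with one reversal: the residues are
tracked by the finite control, and the counter is incremented at every `d`th letter of `a^x` and
decremented at every `d'`th letter of `a^z` (`WindowTest.entryAccepts_unaryWord_iff`). The automaton
that does so does not depend on the input. The input only enters through the first two numbers; a chain
of additional states accepts the words that do not start with them (`WindowTest.machine`,
`WindowTest.machine_universal_iff`). The machine is thus a computable function of the input.

Every word over `{a, b}` is a shuffle of a word in `a*` and a word in `b*`, so that the inclusion of the
shuffle in a language says that this language is universal (`mem_kstar_shuffle_kstar`).
-/

/-! ### Real-time counter machines -/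

theorem length_destutter'_eq_one_of_nonpos (ds : List SignType) (h : ∀ d ∈ ds, d ≤ 0) :
    ((ds.filter fun d => d ≠ 0).destutter' (· ≠ ·) (-1)).length = 1 := by
  induction ds with
  | nil => rfl
  | cons d ds ih =>
    have hd : d ≤ 0 := h d (by simp)
    have ih := ih fun d hd => h d (by simp [hd])
    rcases d with _ | _ | _
    · simpa using ih
    · simpa using ih
    · exact absurd hd (by decide)

theorem counterReversals_eq_zero_of_nonpos (ds : List SignType) (h : ∀ d ∈ ds, d ≤ 0) :
    counterReversals ds = 0 := by
  induction ds with
  | nil => rfl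
  | cons d ds ih =>
    have hd : d ≤ 0 := h d (by simp)
    have h' : ∀ d ∈ ds, d ≤ 0 := fun d hd => h d (by simp [hd])
    rcases d with _ | _ | _
    · simpa [counterReversals] using ih h'
    · have := length_destutter'_eq_one_of_nonpos ds h'
      simp only [counterReversals]
      rw [List.filter_cons_of_pos (by decide)]
      rw [List.destutter_cons']
      exact (congrArg (· - 1) this)
    · exact absurd hd (by decide)

theorem length_destutter'_le_two (us ds : List SignType) (hu : ∀ d ∈ us, 0 ≤ d)
    (h : ∀ d ∈ ds, d ≤ 0) :
    (((us ++ ds).filter fun d => d ≠ 0).destutter' (· ≠ ·) 1).length ≤ 2 := by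
  induction us with
  | nil =>
    induction ds with
    | nil => simp
    | cons d ds ih =>
      have hd : d ≤ 0 := h d (by simp)
      have h' : ∀ d ∈ ds, d ≤ 0 := fun d hd => h d (by simp [hd])
      rcases d with _ | _ | _
      · simpa using ih h'
      · have := length_destutter'_eq_one_of_nonpos ds h'
        simp only [List.nil_append]
        rw [List.filter_cons_of_pos (by decide), List.destutter'_cons_pos _ (by decide)]
        simpa using this.le
      · exact absurd hd (by decide)
  | cons d us ih =>
    have hd : 0 ≤ d := hu d (by simp)
    have ih := ih fun d hd => hu d (by simp [hd])
    rcases d with _ | _ | _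
    · simpa using ih
    · exact absurd hd (by decide)
    · rw [List.cons_append, List.filter_cons_of_pos (by decide),
        List.destutter'_cons_neg _ (by decide)]
      exact ih

theorem counterReversals_append_le_one (us ds : List SignType) (hu : ∀ d ∈ us, 0 ≤ d)
    (h : ∀ d ∈ ds, d ≤ 0) : counterReversals (us ++ ds) ≤ 1 := by
  induction us with
  | nil => simp [counterReversals_eq_zero_of_nonpos ds h]
  | cons d us ih =>
    have hd : 0 ≤ d := hu d (by simp)
    have hu' : ∀ d ∈ us, 0 ≤ d := fun d hd => hu d (by simp [hd])
    rcases d with _ | _ | _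
    · simpa [counterReversals] using ih hu'
    · exact absurd hd (by decide)
    · have := length_destutter'_le_two us ds hu' h
      simp only [counterReversals, List.cons_append]
      rw [List.filter_cons_of_pos (by decide), List.destutter_cons']
      exact Nat.sub_le_of_le_add this

namespace CounterMachine

variable {α : Type}

/-- If the states split into an up-phase and a down-phase `D` that is never left, and the counter
is not decremented in the former and not incremented in the latter, then there is at most one
reversal. -/
theorem reversalBounded_one_of_phases (M : CounterMachine 1 α) (D : Set ℕ)
    (up : ∀ t ∈ M.trans, t.source ∉ D → 0 ≤ t.delta 0)
    (down : ∀ t ∈ M.trans, t.source ∈ D → t.target ∈ D ∧ t.delta 0 ≤ 0) :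
    M.ReversalBounded 1 := by
  have hdown : ∀ c ds c', M.Run c ds c' → c.state ∈ D → ∀ d ∈ ds, d 0 ≤ 0 := by
    intro c ds c' hr
    induction hr with
    | nil => simp
    | cons hs _ ih =>
      obtain ⟨t, ht, w, hsrc, -, -, rfl, htgt, -⟩ := hs
      intro hc
      rw [hsrc] at hc
      obtain ⟨h1, h2⟩ := down t ht hc
      simpa [h2] using ih (htgt ▸ h1)
  have key : ∀ c ds c', M.Run c ds c' → ∃ us vs, ds.map (fun d => d 0) = us ++ vs ∧
      (∀ d ∈ us, 0 ≤ d) ∧ ∀ d ∈ vs, d ≤ 0 := by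
    intro c ds c' hr
    induction hr with
    | nil => exact ⟨[], [], by simp⟩
    | @cons c c' c'' d ds hs hr ih =>
      by_cases hc : c.state ∈ D
      · refine ⟨[], _, rfl, by simp, ?_⟩
        simpa using hdown _ _ _ (.cons hs hr) hc
      · obtain ⟨us, vs, h, hu, hv⟩ := ih
        obtain ⟨t, ht, w, hsrc, -, -, rfl, htgt, -⟩ := hs
        refine ⟨t.delta 0 :: us, vs, by simp [h], ?_, hv⟩
        simpa using ⟨up t ht (hsrc ▸ hc), hu⟩
  intro w ds c hr i
  obtain ⟨us, vs, h, hu, hv⟩ := key _ _ _ hr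
  rw [Subsingleton.elim i 0, h]
  exact counterReversals_append_le_one us vs hu hv

/-- Acceptance by a one-counter machine that reads a letter in every step, from state `q` with
counter contents `n`, by recursion on the remaining word. -/
def RealTimeAccepts (M : CounterMachine 1 α) : ℕ → ℕ → List α → Prop
  | q, _, [] => q ∈ M.final
  | q, n, x :: w => ∃ t ∈ M.trans, t.source = q ∧ t.read = some x ∧
      (t.positive 0 = true ↔ n ≠ 0) ∧
      ∃ n' : ℕ, (n' : ℤ) = n + (t.delta 0 : ℤ) ∧ M.RealTimeAccepts t.target n' w

/-- Every step of the machine reads a letter, and moves on. -/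
def IsRealTime (M : CounterMachine 1 α) : Prop :=
  ∀ t ∈ M.trans, t.advance = true ∧ t.read ≠ none

theorem IsRealTime.exists_run_iff {M : CounterMachine 1 α} (hM : M.IsRealTime) (w : List α) :
    ∀ (q : ℕ) (c : Fin 1 → ℕ),
      (∃ ds, ∃ f ∈ M.final, ∃ c', M.Run ⟨q, w.map some ++ [none], c⟩ ds ⟨f, [none], c'⟩) ↔
        M.RealTimeAccepts q (c 0) w := by
  induction w with
  | nil =>
    intro q c
    constructor
    · rintro ⟨ds, f, hf, c', hr⟩
      cases hr with
      | nil => exact hf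
      | cons hs _ =>
        obtain ⟨t, ht, w, -, hin, -⟩ := hs
        simp only [List.map_nil, List.nil_append, List.cons.injEq] at hin
        exact absurd hin.1.symm (hM t ht).2
    · intro h
      exact ⟨[], q, h, c, .nil _⟩
  | cons x w ih =>
    intro q c
    constructor
    · rintro ⟨ds, f, hf, c', hr⟩
      cases hr with
      | @cons _ c₁ _ d ds hs hr =>
        obtain ⟨t, ht, v, hsrc, hin, hpos, rfl, htgt, hin', hcnt⟩ := hs
        simp only [List.map_cons, List.cons_append, List.cons.injEq] at hin
        obtain ⟨hx, rfl⟩ := hin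
        rw [(hM t ht).1, if_pos rfl] at hin'
        obtain ⟨q₁, i₁, k₁⟩ := c₁
        simp only at hsrc htgt hin' hcnt hpos
        subst htgt hin'
        refine ⟨t, ht, hsrc.symm, hx.symm, hpos 0, k₁ 0, hcnt 0, ?_⟩
        exact (ih _ _).1 ⟨ds, f, hf, c', hr⟩
    · rintro ⟨t, ht, hsrc, hx, hpos, n', hn', hacc⟩
      obtain ⟨ds, f, hf, c', hr⟩ := (ih t.target fun _ => n').2 hacc
      refine ⟨t.delta :: ds, f, hf, c', .cons ⟨t, ht, w.map some ++ [none], hsrc.symm, ?_, ?_, rfl,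
        rfl, ?_, ?_⟩ hr⟩
      · simp [hx]
      · intro i
        rw [Subsingleton.elim i 0]
        exact hpos
      · simp [(hM t ht).1]
      · intro i
        rw [Subsingleton.elim i 0]
        exact hn'

theorem IsRealTime.mem_language_iff {M : CounterMachine 1 α} (hM : M.IsRealTime) (w : List α) :
    w ∈ M.language ↔ M.RealTimeAccepts M.start 0 w :=
  hM.exists_run_iff w M.start fun _ => 0

end CounterMachine

/-! ### Detecting a bad window in a sequence of unary numbers -/

/-- The word `a^x₁ b a^x₂ b ⋯ a^xₙ b` that encodes a sequence of natural numbers. -/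
def unaryWord : List ℕ → List Letter
  | [] => []
  | x :: xs => List.replicate x .a ++ .b :: unaryWord xs

/-- The finite data of a test of triples of natural numbers. A number is read in unary while its
residue, an element of the finite type `R`, is updated by `next`. In mode `i : I`, the counter
counts the residues satisfying `inc i` while the first number is read, and those satisfying `dec i`
while the third number is read. Mode `i` rejects a triple by `bad i`, applied to the three residues
and to the truth value of the equality of the two counts. A number is terminal according to its
residue. -/
structure WindowTest (I R : Type) where
  zero : R
  next : R → R
  inc : I → R → Bool
  dec : I → R → Bool
  bad : I → R → R → R → Prop → Prop
  terminal : R → Prop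

namespace WindowTest

variable {I R : Type} (T : WindowTest I R)

/-- The residue of a number. -/
def residue (n : ℕ) : R := T.next^[n] T.zero

/-- The number of residues satisfying `f` among the first `n` residues from `r` onwards. -/
def count (f : R → Bool) : R → ℕ → ℕ
  | _, 0 => 0
  | r, n + 1 => (if f r then 1 else 0) + count f (T.next r) n

/-- Some mode rejects the triple `(x, y, z)`. -/
def Rejects (x y z : ℕ) : Prop :=
  ∃ i, T.bad i (T.residue x) (T.residue y) (T.residue z)
    (T.count (T.inc i) T.zero x = T.count (T.dec i) T.zero z)

/-- A sequence is good if no window of three consecutive entries is rejected and its last entry, if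
there is one, is terminal. -/
def Good : List ℕ → Prop
  | [] => True
  | [x] => T.terminal (T.residue x)
  | [_, y] => T.terminal (T.residue y)
  | x :: y :: z :: xs => ¬ T.Rejects x y z ∧ Good (y :: z :: xs)

/-- The states of an automaton that searches for a defect in a sequence of numbers: `idle` skips
numbers, `last r` guesses that the current number is the last one, and `first`, `second`, `third`
read the numbers of a window, remembering the mode and the residues. The truth value in `third`
tells whether the counter was zero when it should have been decremented. In `accept`, a bad window
has been found and the rest of the word is arbitrary; in `done`, a defect has been found at the end
of the word, which must be over. -/
inductive State (I R : Type) : Type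
  | idle
  | accept
  | done
  | last (r : R)
  | first (i : I) (r : R)
  | second (i : I) (r s : R)
  | third (i : I) (r s t : R) (exhausted : Bool)

instance [Finite I] [Finite R] : Finite (State I R) :=
  Finite.of_injective (β := Option (Option (Option (R ⊕ (I × R) ⊕ (I × R × R) ⊕
      (I × R × R × R × Bool)))))
    (fun s => match s with
      | .idle => none
      | .accept => some none
      | .done => some (some none)
      | .last r => some (some (some (.inl r)))
      | .first i r => some (some (some (.inr (.inl (i, r)))))
      | .second i r s => some (some (some (.inr (.inr (.inl (i, r, s))))))
      | .third i r s t u => some (some (some (.inr (.inr (.inr (i, r, s, t, u)))))))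
    (by intro s s' h; cases s <;> cases s' <;> simp_all)

/-- The states in which a number starts. -/
inductive Entry : State I R → Prop
  | idle : Entry .idle
  | last : Entry (.last T.zero)
  | first (i : I) : Entry (.first i T.zero)

/-- The transitions of the automaton: in the given state, on the given letter, and with the counter
being positive or not, it may go to the given state and change the counter as given. -/
inductive Step : State I R → Letter → Bool → State I R → SignType → Prop
  | idle_a (p) : Step .idle .a p .idle 0
  | idle_done (p) : Step .idle .a p .done 0
  | idle_b (p) {s} : T.Entry s → Step .idle .b p s 0
  | accept (x p) : Step .accept x p .accept 0
  | last_a (r p) : Step (.last r) .a p (.last (T.next r)) 0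
  | last_b (r p) : ¬ T.terminal r → Step (.last r) .b p .done 0
  | first_inc (i r p) : T.inc i r = true → Step (.first i r) .a p (.first i (T.next r)) 1
  | first_a (i r p) : T.inc i r = false → Step (.first i r) .a p (.first i (T.next r)) 0
  | first_b (i r p) : Step (.first i r) .b p (.second i r T.zero) 0
  | second_a (i r s p) : Step (.second i r s) .a p (.second i r (T.next s)) 0
  | second_b (i r s p) : Step (.second i r s) .b p (.third i r s T.zero false) 0
  | third_dec (i r s t u) : T.dec i t = true →
      Step (.third i r s t u) .a true (.third i r s (T.next t) u) (-1)
  | third_exhausted (i r s t u) : T.dec i t = true →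
      Step (.third i r s t u) .a false (.third i r s (T.next t) true) 0
  | third_a (i r s t u p) : T.dec i t = false →
      Step (.third i r s t u) .a p (.third i r s (T.next t) u) 0
  | third_b (i r s t u p) : T.bad i r s t (u = false ∧ p = false) →
      Step (.third i r s t u) .b p .accept 0

/-- Acceptance of a word from a given state with given counter contents. -/
def Accepts : State I R → ℕ → List Letter → Prop
  | s, _, [] => s = .accept ∨ s = .done
  | s, n, x :: w => ∃ s' d, T.Step s x (decide (n ≠ 0)) s' d ∧
      ∃ n' : ℕ, (n' : ℤ) = n + (d : ℤ) ∧ Accepts s' n' w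

/-- Acceptance of a word that starts with a number. -/
def EntryAccepts (w : List Letter) : Prop := ∃ s, T.Entry s ∧ T.Accepts s 0 w

theorem accepts_accept (n : ℕ) (w : List Letter) : T.Accepts .accept n w := by
  induction w generalizing n with
  | nil => exact .inl rfl
  | cons x w ih => exact ⟨_, _, .accept x _, n, by simp, ih n⟩

theorem accepts_done_iff (n : ℕ) (w : List Letter) : T.Accepts .done n w ↔ w = [] := by
  cases w with
  | nil => simp [Accepts]
  | cons x w =>
    simp only [Accepts, reduceCtorEq, iff_false]
    rintro ⟨s, d, ⟨⟩, -⟩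

theorem accepts_last_replicate_iff (r : R) (n x : ℕ) (w : List Letter) :
    T.Accepts (.last r) n (List.replicate x .a ++ .b :: w) ↔
      ¬ T.terminal (T.next^[x] r) ∧ w = [] := by
  induction x generalizing r with
  | zero =>
    constructor
    · rintro ⟨s, d, hs, n', -, h⟩
      cases hs with
      | last_b _ _ ht => exact ⟨ht, (T.accepts_done_iff _ _).1 h⟩
    · rintro ⟨ht, rfl⟩
      exact ⟨_, _, .last_b _ _ ht, n, by simp, .inr rfl⟩
  | succ x ih =>
    rw [Function.iterate_succ_apply, ← ih]
    constructor
    · rintro ⟨s, d, hs, n', hn, h⟩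
      cases hs
      obtain rfl : n' = n := by simpa using hn
      exact h
    · intro h
      exact ⟨_, _, .last_a _ _, n, by simp, h⟩

/-- The counter is `n` minus the count as long as that is nonnegative, so it is zero at the end without
having been exhausted just if `n` is the count. -/
theorem accepts_third_replicate_iff (i : I) (r s t : R) (u : Bool) (n x : ℕ) (w : List Letter)
    (hu : u = true → n = 0) :
    T.Accepts (.third i r s t u) n (List.replicate x .a ++ .b :: w) ↔
      T.bad i r s (T.next^[x] t) (u = false ∧ n = T.count (T.dec i) t x) := by
  induction x generalizing t u n with
  | zero =>
    constructor
    · rintro ⟨s, d, hs, n', -, h⟩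
      cases hs with
      | third_b _ _ _ _ _ _ hb => simpa [count] using hb
    · intro hb
      exact ⟨_, _, .third_b _ _ _ _ _ _ (by simpa [count] using hb), n, by simp,
        T.accepts_accept _ _⟩
  | succ x ih =>
    rw [Function.iterate_succ_apply]
    constructor
    · rintro ⟨s, d, hs, n', hn, h⟩
      generalize hp : decide (n ≠ 0) = p at hs
      cases hs with
      | third_dec _ _ _ _ _ hd =>
        have hn0 : n ≠ 0 := by simpa using hp
        have hn' : n = n' + 1 := by
          have : ((-1 : SignType) : ℤ) = -1 := rfl
          rw [this] at hn; omega
        replace h := (ih _ _ _ fun hu' => absurd (hu hu') hn0).1 h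
        have e : (n = T.count (T.dec i) t (x + 1)) ↔ (n' = T.count (T.dec i) (T.next t) x) := by
          simp only [count, hd, if_true]; omega
        rwa [e]
      | third_exhausted _ _ _ _ _ hd =>
        have hn0 : n = 0 := by simpa using hp
        obtain rfl : n' = n := by simpa using hn
        replace h := (ih _ _ _ fun _ => hn0).1 h
        have e : ¬ (n' = T.count (T.dec i) t (x + 1)) := by
          simp only [count, hd, if_true]; omega
        simpa [e] using h
      | third_a _ _ _ _ _ _ hd =>
        obtain rfl : n' = n := by simpa using hn
        replace h := (ih _ _ _ hu).1 h
        simpa [count, hd] using h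
    · intro h
      rcases hd : T.dec i t with _ | _
      · refine ⟨_, _, .third_a _ _ _ _ _ _ hd, n, by simp, ?_⟩
        refine (ih _ _ _ hu).2 ?_
        simpa [count, hd] using h
      · rcases n with _ | n
        · refine ⟨_, _, .third_exhausted _ _ _ _ _ hd, 0, by simp, ?_⟩
          refine (ih _ _ _ fun _ => rfl).2 ?_
          have e : ¬ (0 = T.count (T.dec i) t (x + 1)) := by
            simp only [count, hd, if_true]; omega
          simpa [e] using h
        · refine ⟨_, _, .third_dec _ _ _ _ _ hd, n, ?_, ?_⟩
          · have : ((-1 : SignType) : ℤ) = -1 := rfl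
            rw [this]; push_cast; ring
          refine (ih _ _ _ fun hu' => absurd (hu hu') (by omega)).2 ?_
          have e : (n + 1 = T.count (T.dec i) t (x + 1)) ↔
              (n = T.count (T.dec i) (T.next t) x) := by
            simp only [count, hd, if_true]; omega
          rwa [e] at h

theorem accepts_second_replicate_iff (i : I) (r s : R) (n y : ℕ) (w : List Letter) :
    T.Accepts (.second i r s) n (List.replicate y .a ++ .b :: w) ↔
      T.Accepts (.third i r (T.next^[y] s) T.zero false) n w := by
  induction y generalizing s with
  | zero =>
    constructor
    · rintro ⟨s, d, hs, n', hn, h⟩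
      cases hs
      obtain rfl : n' = n := by simpa using hn
      exact h
    · intro h
      exact ⟨_, _, .second_b _ _ _ _, n, by simp, h⟩
  | succ y ih =>
    rw [Function.iterate_succ_apply, ← ih]
    constructor
    · rintro ⟨s, d, hs, n', hn, h⟩
      cases hs
      obtain rfl : n' = n := by simpa using hn
      exact h
    · intro h
      exact ⟨_, _, .second_a _ _ _ _, n, by simp, h⟩

theorem accepts_first_replicate_iff (i : I) (r : R) (n x : ℕ) (w : List Letter) :
    T.Accepts (.first i r) n (List.replicate x .a ++ .b :: w) ↔
      T.Accepts (.second i (T.next^[x] r) T.zero) (n + T.count (T.inc i) r x) w := by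
  induction x generalizing r n with
  | zero =>
    constructor
    · rintro ⟨s, d, hs, n', hn, h⟩
      cases hs
      obtain rfl : n' = n := by simpa using hn
      exact h
    · intro h
      exact ⟨_, _, .first_b _ _ _, n, by simp, h⟩
  | succ x ih =>
    rw [Function.iterate_succ_apply]
    rcases hd : T.inc i r with _ | _
    · rw [count, hd, if_neg (by simp), zero_add, ← ih]
      constructor
      · rintro ⟨s, d, hs, n', hn, h⟩
        cases hs with
        | first_inc _ _ _ h' => simp [hd] at h'
        | first_a =>
          obtain rfl : n' = n := by simpa using hn
          exact h
      · intro h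
        exact ⟨_, _, .first_a _ _ _ hd, n, by simp, h⟩
    · rw [count, hd, if_pos rfl, ← add_assoc, ← ih]
      constructor
      · rintro ⟨s, d, hs, n', hn, h⟩
        cases hs with
        | first_inc =>
          obtain rfl : n' = n + 1 := by
            have : ((1 : SignType) : ℤ) = 1 := rfl
            rw [this] at hn; omega
          exact h
        | first_a _ _ _ h' => simp [hd] at h'
      · intro h
        exact ⟨_, _, .first_inc _ _ _ hd, n + 1, by simp, h⟩

theorem accepts_idle_replicate_iff (n x : ℕ) (w : List Letter) :
    T.Accepts .idle n (List.replicate x .a ++ .b :: w) ↔ ∃ s, T.Entry s ∧ T.Accepts s n w := by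
  induction x with
  | zero =>
    constructor
    · rintro ⟨s, d, hs, n', hn, h⟩
      cases hs with
      | idle_b _ he =>
        obtain rfl : n' = n := by simpa using hn
        exact ⟨_, he, h⟩
    · rintro ⟨s, he, h⟩
      exact ⟨_, _, .idle_b _ he, n, by simp, h⟩
  | succ x ih =>
    rw [← ih]
    constructor
    · rintro ⟨s, d, hs, n', hn, h⟩
      cases hs with
      | idle_a =>
        obtain rfl : n' = n := by simpa using hn
        exact h
      | idle_done =>
        rw [accepts_done_iff] at h
        simp at h
    · intro h
      exact ⟨_, _, .idle_a _, n, by simp, h⟩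

/-- A word that ends in `a` encodes no sequence, and is accepted. -/
theorem accepts_idle_concat_a (n : ℕ) (w : List Letter) : T.Accepts .idle n (w ++ [.a]) := by
  induction w with
  | nil => exact ⟨_, _, .idle_done _, n, by simp, .inr rfl⟩
  | cons x w ih =>
    cases x with
    | a => exact ⟨_, _, .idle_a _, n, by simp, ih⟩
    | b => exact ⟨_, _, .idle_b _ .idle, n, by simp, ih⟩

theorem not_accepts_second_nil (i : I) (r s : R) (n : ℕ) : ¬ T.Accepts (.second i r s) n [] := by
  simp [Accepts]

theorem not_accepts_third_nil (i : I) (r s t : R) (u : Bool) (n : ℕ) :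
    ¬ T.Accepts (.third i r s t u) n [] := by
  simp [Accepts]

/-- The automaton finds a defect in the encoding of a sequence just if the sequence is not good. -/
theorem entryAccepts_unaryWord_iff (xs : List ℕ) :
    T.EntryAccepts (unaryWord xs) ↔ ¬ T.Good xs := by
  have split : ∀ w, T.EntryAccepts w ↔ T.Accepts .idle 0 w ∨ T.Accepts (.last T.zero) 0 w ∨
      ∃ i, T.Accepts (.first i T.zero) 0 w := by
    intro w
    constructor
    · rintro ⟨s, hs, h⟩
      cases hs with
      | idle => exact .inl h
      | last => exact .inr (.inl h)
      | first i => exact .inr (.inr ⟨i, h⟩)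
    · rintro (h | h | ⟨i, h⟩)
      · exact ⟨_, .idle, h⟩
      · exact ⟨_, .last, h⟩
      · exact ⟨_, .first i, h⟩
  induction xs with
  | nil => simp [split, unaryWord, Accepts, Good]
  | cons x xs ih =>
    rw [split, unaryWord, accepts_idle_replicate_iff]
    refine (or_congr_left ih).trans ?_
    rw [accepts_last_replicate_iff]
    simp only [accepts_first_replicate_iff]
    rcases xs with _ | ⟨y, _ | ⟨z, xs⟩⟩
    · simp [unaryWord, Good, not_accepts_second_nil, residue]
    · simp [unaryWord, Good, accepts_second_replicate_iff, not_accepts_third_nil]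
    · simp only [unaryWord, accepts_second_replicate_iff]
      have h3 := fun i r s n w => T.accepts_third_replicate_iff i r s T.zero false n z w (by simp)
      simp only [h3, Good, not_and_or, not_not, Rejects, residue]
      simp [or_comm]

/-- Every word encodes a sequence or ends in `a`. -/
theorem _root_.exists_eq_unaryWord_or_concat_a (w : List Letter) :
    (∃ xs, w = unaryWord xs) ∨ ∃ v, w = v ++ [.a] := by
  induction w with
  | nil => exact .inl ⟨[], rfl⟩
  | cons x w ih =>
    rcases ih with ⟨xs, rfl⟩ | ⟨v, rfl⟩
    · cases x with
      | b => exact .inl ⟨0 :: xs, rfl⟩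
      | a =>
        cases xs with
        | nil => exact .inr ⟨[], rfl⟩
        | cons x xs => exact .inl ⟨(x + 1) :: xs, by simp [unaryWord, List.replicate_succ]⟩
    · exact .inr ⟨x :: v, rfl⟩

theorem entryAccepts_concat_a (w : List Letter) : T.EntryAccepts (w ++ [.a]) :=
  ⟨_, .idle, T.accepts_idle_concat_a 0 w⟩

end WindowTest

/-! ### The counter machine that searches for a defect -/

instance : Finite Letter := Finite.of_equiv Bool Letter.equivBool.symm

theorem unaryWord_append (xs ys : List ℕ) :
    unaryWord (xs ++ ys) = unaryWord xs ++ unaryWord ys := by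
  induction xs with
  | nil => rfl
  | cons x xs ih => simp [unaryWord, ih]

namespace WindowTest

variable {I R : Type} (T : WindowTest I R) {K : ℕ} (e : State I R ≃ Fin K)

/-- The transitions of the automaton as transitions of a counter machine, its states being numbered
by `e`, together with transitions on `b` from the additional state `K` to the entry states. -/
def stepTransitions : Set (CounterTransition 1 Letter) :=
  {t | (∃ s x p s' d, T.Step s x p s' d ∧
      t = ⟨e s, some x, fun _ => p, e s', true, fun _ => d⟩) ∨
    ∃ s, T.Entry s ∧ t = ⟨K, some .b, fun _ => false, e s, true, fun _ => 0⟩}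

theorem finite_stepTransitions : (T.stepTransitions e).Finite := by
  have := Finite.of_equiv _ e.symm
  refine ((Set.finite_range fun y : State I R × Letter × Bool × State I R × SignType =>
      (⟨e y.1, some y.2.1, fun _ => y.2.2.1, e y.2.2.2.1, true, fun _ => y.2.2.2.2⟩ :
        CounterTransition 1 Letter)).union (Set.finite_range fun s : State I R =>
      (⟨K, some .b, fun _ => false, e s, true, fun _ => 0⟩ :
        CounterTransition 1 Letter))).subset ?_
  rintro t (⟨s, x, p, s', d, -, rfl⟩ | ⟨s, -, rfl⟩)
  · exact .inl ⟨(s, x, p, s', d), rfl⟩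
  · exact .inr ⟨s, rfl⟩

/-- Transitions from the states `K + i`, in which the first `i` letters of `P` have been read:
reading the next letter of `P` leads to `K + i + 1`, and the other letter leads to `acc`. -/
def prefixTransitions (K acc : ℕ) (P : List Letter) : List (CounterTransition 1 Letter) :=
  (List.range P.length).flatMap fun i => [Letter.a, Letter.b].map fun x =>
    ⟨K + i, some x, fun _ => false, if P.getD i .a = x then K + i + 1 else acc, true, fun _ => 0⟩

theorem mem_prefixTransitions_iff (K acc : ℕ) (P : List Letter) (t : CounterTransition 1 Letter) :
    t ∈ prefixTransitions K acc P ↔ ∃ i < P.length, ∃ x, t = ⟨K + i, some x, fun _ => false,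
      if P.getD i .a = x then K + i + 1 else acc, true, fun _ => 0⟩ := by
  simp only [prefixTransitions, List.mem_flatMap, List.mem_range, List.mem_map, List.mem_cons,
    List.not_mem_nil, or_false]
  constructor
  · rintro ⟨i, hi, x, -, rfl⟩
    exact ⟨i, hi, x, rfl⟩
  · rintro ⟨i, hi, x, rfl⟩
    exact ⟨i, hi, x, by cases x <;> simp, rfl⟩

/-- The counter machine that accepts a word if it does not start with `P`, or if it is `b` followed
by a word in which the automaton finds a defect. -/
noncomputable def machine (P : List Letter) : CounterMachine 1 Letter where
  numStates := K + P.length + 1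
  start := K
  final := [(e .accept : ℕ), (e .done : ℕ)] ++ (List.range P.length).map (K + ·)
  trans := (T.finite_stepTransitions e).toFinset.toList ++ prefixTransitions K (e .accept) P

variable (P : List Letter)

theorem mem_machine_trans_iff (t : CounterTransition 1 Letter) :
    t ∈ (T.machine e P).trans ↔ ((∃ s x p s' d, T.Step s x p s' d ∧
      t = ⟨e s, some x, fun _ => p, e s', true, fun _ => d⟩) ∨
      ∃ s, T.Entry s ∧ t = ⟨K, some .b, fun _ => false, e s, true, fun _ => 0⟩) ∨
      ∃ i < P.length, ∃ x, t = ⟨K + i, some x, fun _ => false,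
        if P.getD i .a = x then K + i + 1 else e .accept, true, fun _ => 0⟩ := by
  simp only [machine, List.mem_append, mem_prefixTransitions_iff, Finset.mem_toList,
    Set.Finite.mem_toFinset]
  rfl

theorem isRealTime_machine : (T.machine e P).IsRealTime := by
  intro t ht
  rw [mem_machine_trans_iff] at ht
  rcases ht with (⟨s, x, p, s', d, -, rfl⟩ | ⟨s, -, rfl⟩) | ⟨i, -, x, rfl⟩ <;> simp

theorem Step.nonneg_of_zero {T : WindowTest I R} {s s' : State I R} {x : Letter} {d : SignType}
    (h : T.Step s x false s' d) : 0 ≤ d := by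
  cases h <;> decide

theorem wellFormed_machine : (T.machine e P).WellFormed where
  start_lt := by simp only [machine]; omega
  final_lt q hq := by
    have h1 := (e .accept).isLt
    have h2 := (e .done).isLt
    simp only [machine, List.mem_append, List.mem_cons, List.not_mem_nil, or_false, List.mem_map,
      List.mem_range] at hq ⊢
    rcases hq with (rfl | rfl) | ⟨i, hi, rfl⟩ <;> omega
  trans_lt t ht := by
    rw [mem_machine_trans_iff] at ht
    have h1 := (e .accept).isLt
    simp only [machine]
    rcases ht with (⟨s, x, p, s', d, -, rfl⟩ | ⟨s, -, rfl⟩) | ⟨i, hi, x, rfl⟩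
    · have h2 := (e s).isLt
      have h3 := (e s').isLt
      simp only
      omega
    · have h2 := (e s).isLt
      simp only
      omega
    · simp only
      split_ifs <;> omega
  delta_nonneg t ht i hi := by
    rw [mem_machine_trans_iff] at ht
    rcases ht with (⟨s, x, p, s', d, hs, rfl⟩ | ⟨s, -, rfl⟩) | ⟨i, hi, x, rfl⟩
    · obtain rfl : p = false := hi
      exact hs.nonneg_of_zero
    · exact le_rfl
    · exact le_rfl

/-- The counter is decremented only while the third number of a window is read, and never changed
afterwards. -/
theorem reversalBounded_machine : (T.machine e P).ReversalBounded 1 := by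
  refine CounterMachine.reversalBounded_one_of_phases _
    {q | q = e .accept ∨ ∃ i r s t u, q = e (.third i r s t u)} ?_ ?_
  · intro t ht hD
    rw [mem_machine_trans_iff] at ht
    rcases ht with (⟨s, x, p, s', d, hs, rfl⟩ | ⟨s, -, rfl⟩) | ⟨i, hi, x, rfl⟩
    · simp only [Set.mem_ofPred_eq, Fin.val_inj, e.injective.eq_iff, not_or, not_exists] at hD
      cases hs with
      | third_dec i r s t u => exact absurd rfl (hD.2 i r s t u)
      | _ => first | exact le_rfl | exact (by decide : (0 : SignType) ≤ 1)
    · exact le_rfl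
    · exact le_rfl
  · intro t ht hD
    rw [mem_machine_trans_iff] at ht
    rcases ht with (⟨s, x, p, s', d, hs, rfl⟩ | ⟨s, -, rfl⟩) | ⟨i, hi, x, rfl⟩
    · simp only [Set.mem_ofPred_eq, Fin.val_inj, e.injective.eq_iff] at hD ⊢
      rcases hD with rfl | ⟨i, r, s, t, u, rfl⟩
      · cases hs
        simp
      · cases hs <;> simp
    · rcases hD with h | ⟨i, r, s, t, u, h⟩
      · exact absurd h (e _).isLt.ne'
      · exact absurd h (e _).isLt.ne'
    · have : ∀ s, K + i ≠ e s := fun s => by have := (e s).isLt; omega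
      rcases hD with h | ⟨i, r, s, t, u, h⟩ <;> exact absurd h (this _)

theorem isNCM_machine : IsNCM 1 1 (T.machine e P) :=
  ⟨T.wellFormed_machine e P, T.reversalBounded_machine e P⟩

theorem machine_accepts_state_iff (s : State I R) (n : ℕ) (w : List Letter) :
    (T.machine e P).RealTimeAccepts (e s) n w ↔ T.Accepts s n w := by
  induction w generalizing s n with
  | nil =>
    have h : ∀ i, K + i ≠ e s := fun i => by have := (e s).isLt; omega
    simp [CounterMachine.RealTimeAccepts, Accepts, machine, Fin.val_inj, h]
  | cons x w ih =>
    constructor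
    · rintro ⟨t, ht, hsrc, hx, hp, n', hn', h⟩
      rw [mem_machine_trans_iff] at ht
      rcases ht with (⟨s₁, x, p, s', d, hs, rfl⟩ | ⟨s, -, rfl⟩) | ⟨i, hi, x, rfl⟩
      · obtain rfl := e.injective (Fin.val_injective hsrc)
        simp only [Option.some.injEq] at hx
        subst hx
        have : p = decide (n ≠ 0) := Bool.eq_iff_iff.2 (by simpa using hp)
        exact ⟨s', d, this ▸ hs, n', hn', (ih _ _).1 h⟩
      · exact absurd hsrc (e _).isLt.ne'
      · have := (e s).isLt
        simp only at hsrc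
        omega
    · rintro ⟨s', d, hs, n', hn', h⟩
      exact ⟨_, (T.mem_machine_trans_iff e P _).2 (.inl (.inl ⟨s, x, _, s', d, hs, rfl⟩)), rfl, rfl,
        by simp, n', hn', (ih _ _).2 h⟩

theorem machine_accepts_prefix_cons_iff (i : ℕ) (hi : i ≤ P.length) (x : Letter)
    (w : List Letter) :
    (T.machine e P).RealTimeAccepts (K + i) 0 (x :: w) ↔
      (i < P.length ∧ (P.getD i .a = x → (T.machine e P).RealTimeAccepts (K + i + 1) 0 w)) ∨
      (i = 0 ∧ x = .b ∧ T.EntryAccepts w) := by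
  constructor
  · rintro ⟨t, ht, hsrc, hx, hp, n', hn', h⟩
    rw [mem_machine_trans_iff] at ht
    rcases ht with (⟨s, x, p, s', d, hs, rfl⟩ | ⟨s, hs, rfl⟩) | ⟨j, hj, x, rfl⟩
    · have := (e s).isLt
      simp only at hsrc
      omega
    · simp only [Option.some.injEq] at hsrc hx
      obtain rfl : n' = 0 := by simpa using hn'
      exact .inr ⟨by omega, hx.symm, s, hs, (T.machine_accepts_state_iff e P _ _ _).1 h⟩
    · simp only [Option.some.injEq, Nat.add_left_cancel_iff] at hsrc hx
      subst hsrc hx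
      obtain rfl : n' = 0 := by simpa using hn'
      refine .inl ⟨hj, fun he => ?_⟩
      simpa only [if_pos he] using h
  · rintro (⟨hlt, h⟩ | ⟨rfl, rfl, s, hs, h⟩)
    · refine ⟨_, (T.mem_machine_trans_iff e P _).2 (.inr ⟨i, hlt, x, rfl⟩), rfl, rfl, by simp, 0,
        by simp, ?_⟩
      by_cases hx : P.getD i .a = x
      · simpa only [if_pos hx] using h hx
      · simp only [if_neg hx]
        exact (T.machine_accepts_state_iff e P _ _ _).2 (T.accepts_accept _ _)
    · exact ⟨_, (T.mem_machine_trans_iff e P _).2 (.inl (.inr ⟨s, hs, rfl⟩)), rfl, rfl, by simp, 0,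
        by simp, (T.machine_accepts_state_iff e P _ _ _).2 h⟩

theorem machine_accepts_prefix_nil_iff (i n : ℕ) :
    (T.machine e P).RealTimeAccepts (K + i) n [] ↔ i < P.length := by
  have h : ∀ s, K + i ≠ e s := fun s => by have := (e s).isLt; omega
  simp [CounterMachine.RealTimeAccepts, machine, h]

/-- From state `K + i`, the words that do not start with the rest of `P` are accepted. State `K` itself
has further transitions. -/
theorem machine_accepts_prefix_iff (i : ℕ) (h0 : i ≠ 0) (hi : i ≤ P.length) (w : List Letter) :
    (T.machine e P).RealTimeAccepts (K + i) 0 w ↔ ¬ P.drop i <+: w := by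
  induction w generalizing i with
  | nil =>
    rw [machine_accepts_prefix_nil_iff, List.prefix_nil, List.drop_eq_nil_iff, not_le]
  | cons x w ih =>
    rw [machine_accepts_prefix_cons_iff _ _ _ _ hi]
    rcases hi.lt_or_eq with hlt | rfl
    · rw [add_assoc, ih (i + 1) (by omega) hlt, List.drop_eq_getElem_cons hlt,
        List.cons_prefix_cons, List.getD_eq_getElem _ _ hlt]
      simp [h0, hlt]
    · simp [h0]

theorem mem_machine_language_iff (w : List Letter) :
    w ∈ (T.machine e (.b :: P)).language ↔
      ∀ v, w = .b :: (P ++ v) → T.EntryAccepts (P ++ v) := by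
  rw [(T.isRealTime_machine e _).mem_language_iff]
  change (T.machine e (.b :: P)).RealTimeAccepts (K + 0) 0 w ↔ _
  cases w with
  | nil =>
    rw [machine_accepts_prefix_nil_iff]
    simp
  | cons x w =>
    rw [machine_accepts_prefix_cons_iff _ _ _ _ (Nat.zero_le _), add_assoc,
      machine_accepts_prefix_iff _ _ _ _ (by omega) (by simp)]
    simp only [List.length_cons, Nat.zero_lt_succ, true_and, List.getD_cons_zero, zero_add,
      List.drop_succ_cons, List.drop_zero, List.cons.injEq]
    constructor
    · rintro (h | ⟨-, h⟩) v ⟨rfl, rfl⟩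
      · exact absurd (List.prefix_append P v) (h rfl)
      · exact h
    · intro h
      by_cases hx : x = .b
      · subst hx
        by_cases hp : P <+: w
        · obtain ⟨v, rfl⟩ := hp
          exact .inr ⟨rfl, h v ⟨rfl, rfl⟩⟩
        · exact .inl fun _ => hp
      · exact .inl fun hx' => absurd hx'.symm hx

/-- Started with the encoding of `ys` as the prefix to be checked, the machine accepts all words
just if `ys` has no good continuation. -/
theorem machine_universal_iff (ys : List ℕ) :
    (∀ w, w ∈ (T.machine e (.b :: unaryWord ys)).language) ↔ ∀ xs, ¬ T.Good (ys ++ xs) := by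
  simp only [mem_machine_language_iff]
  constructor
  · intro h xs
    rw [← entryAccepts_unaryWord_iff, unaryWord_append]
    exact h _ _ rfl
  · rintro h w v -
    rcases exists_eq_unaryWord_or_concat_a v with ⟨xs, rfl⟩ | ⟨v, rfl⟩
    · rw [← unaryWord_append, entryAccepts_unaryWord_iff]
      exact h xs
    · rw [← List.append_assoc]
      exact T.entryAccepts_concat_a _

end WindowTest

/-! ### Computability of the construction -/

theorem CounterTransition.primrec_mk {X : Type} [Primcodable X] {q q' : X → ℕ} {x : X → Letter}
    (hq : Primrec q) (hx : Primrec x) (hq' : Primrec q') (p : Fin 1 → Bool) (d : Fin 1 → SignType) :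
    Primrec fun y => (⟨q y, some (x y), p, q' y, true, d⟩ : CounterTransition 1 Letter) := by
  have h : Primrec fun y => CounterTransition.equivTuple.symm
      (q y, some (x y), p, q' y, true, d) :=
    (Primrec.of_equiv_symm (e := CounterTransition.equivTuple (k := 1) (α := Letter))).comp
      (hq.pair ((Primrec.option_some.comp hx).pair ((Primrec.const p).pair
        (hq'.pair ((Primrec.const true).pair (Primrec.const d))))))
  exact h

theorem WindowTest.primrec_prefixTransitions (K acc : ℕ) :
    Primrec (WindowTest.prefixTransitions K acc) := by
  unfold WindowTest.prefixTransitions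
  refine Primrec.list_flatMap (Primrec.list_range.comp Primrec.list_length) ?_
  refine Primrec.list_map (Primrec.const _) ?_
  have hi : Primrec fun y : (List Letter × ℕ) × Letter => K + y.1.2 :=
    Primrec.nat_add.comp (Primrec.const K) (Primrec.snd.comp Primrec.fst)
  refine CounterTransition.primrec_mk hi Primrec.snd ?_ _ _
  refine Primrec.ite ?_ (Primrec.succ.comp hi) (Primrec.const acc)
  exact Primrec.eq.comp ((Primrec.list_getD Letter.a).comp (Primrec.fst.comp Primrec.fst)
    (Primrec.snd.comp Primrec.fst)) Primrec.snd

theorem WindowTest.primrec_machine {I R : Type} (T : WindowTest I R) {K : ℕ}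
    (e : State I R ≃ Fin K) : Primrec (T.machine e) := by
  have h : Primrec fun P => CounterMachine.equivTuple.symm
      (K + P.length + 1, K,
        [(e .accept : ℕ), (e .done : ℕ)] ++ (List.range P.length).map (K + ·),
        (T.finite_stepTransitions e).toFinset.toList ++
          WindowTest.prefixTransitions K (e .accept) P) := by
    refine (Primrec.of_equiv_symm (e := CounterMachine.equivTuple (k := 1) (α := Letter))).comp ?_
    refine .pair ?_ (.pair (Primrec.const _) (.pair ?_ ?_))
    · exact Primrec.succ.comp (Primrec.nat_add.comp (Primrec.const K) Primrec.list_length)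
    · exact Primrec.list_append.comp (Primrec.const _)
        (Primrec.list_map (Primrec.list_range.comp Primrec.list_length)
          (Primrec.nat_add.comp (Primrec.const K) Primrec.snd))
    · exact Primrec.list_append.comp (Primrec.const _) (primrec_prefixTransitions _ _)
  exact h

theorem primrec_unaryWord : Primrec unaryWord := by
  have ha : Primrec fun x : ℕ => List.replicate x Letter.a := by
    refine (Primrec.list_map Primrec.list_range
      (Primrec.const Letter.a).to₂ : Primrec fun x => (List.range x).map fun _ => Letter.a).of_eq ?_
    intro n
    simp [List.map_const']
  have h : Primrec fun xs : List ℕ => xs.flatMap fun x => List.replicate x .a ++ [Letter.b] :=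
    Primrec.list_flatMap Primrec.id
      (Primrec.list_append.comp (ha.comp Primrec.snd) (Primrec.const _))
  refine h.of_eq fun xs => ?_
  induction xs with
  | nil => rfl
  | cons x xs ih => simp [unaryWord, ← ih]

/-! ### Halting computations of Turing machines as good sequences -/

namespace TapeCode

open Turing StateTransition

variable {k b : ℕ}

/-- A `ListBlank` of digits as a number in base `b + 1`, the head being the least significant
digit. -/
def ofListBlank (l : ListBlank (Fin (b + 1))) : ℕ :=
  l.liftOn (fun l => Nat.ofDigits (b + 1) (l.map Fin.val)) (by
    rintro l _ ⟨n, rfl⟩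
    simp)

theorem ofListBlank_mk (l : List (Fin (b + 1))) :
    ofListBlank (ListBlank.mk l) = Nat.ofDigits (b + 1) (l.map Fin.val) := rfl

theorem ofListBlank_cons (a : Fin (b + 1)) (l : ListBlank (Fin (b + 1))) :
    ofListBlank (l.cons a) = a + (b + 1) * ofListBlank l := by
  induction l using ListBlank.induction_on with
  | h l => rw [ListBlank.cons_mk, ofListBlank_mk, List.map_cons, Nat.ofDigits_cons, ofListBlank_mk]

theorem ofListBlank_mod (l : ListBlank (Fin (b + 1))) :
    ofListBlank l % (b + 1) = l.head := by
  conv_lhs => rw [← l.cons_head_tail, ofListBlank_cons]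
  rw [Nat.add_mul_mod_self_left, Nat.mod_eq_of_lt l.head.isLt]

theorem ofListBlank_div (l : ListBlank (Fin (b + 1))) :
    ofListBlank l / (b + 1) = ofListBlank l.tail := by
  conv_lhs => rw [← l.cons_head_tail, ofListBlank_cons]
  rw [Nat.add_mul_div_left _ _ (Nat.succ_pos b), Nat.div_eq_of_lt l.head.isLt, zero_add]

/-- The finite part of a number in a history: which half of the tape the number stands for (`true`
for the right half), the state of the machine and the scanned symbol. -/
abbrev Cell (k b : ℕ) : Type := Bool × Fin (k + 1) × Fin (b + 1)

/-- The number of cells. -/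
abbrev numCells (k b : ℕ) : ℕ := Fintype.card (Cell k b)

theorem numCells_pos : 0 < numCells k b := Fintype.card_pos

/-- The number that encodes a cell `c` and a half-tape `v`. -/
noncomputable def code (c : Cell k b) (v : ℕ) : ℕ :=
  numCells k b * v + Fintype.equivFin (Cell k b) c

/-- The cell encoded by a number. -/
noncomputable def cell (k b : ℕ) (x : ℕ) : Cell k b :=
  (Fintype.equivFin (Cell k b)).symm ⟨x % numCells k b, Nat.mod_lt _ numCells_pos⟩

/-- The last digit of the half-tape encoded by a number. -/
def digit (k b : ℕ) (x : ℕ) : ℕ := x / numCells k b % (b + 1)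

@[simp]
theorem cell_code (c : Cell k b) (v : ℕ) : cell k b (code c v) = c := by
  rw [cell, Equiv.symm_apply_eq, Fin.ext_iff]
  simp only [code]
  rw [Nat.mul_add_mod, Nat.mod_eq_of_lt (Fin.isLt _)]

@[simp]
theorem code_div (c : Cell k b) (v : ℕ) : code c v / numCells k b = v := by
  rw [code, Nat.mul_add_div numCells_pos, Nat.div_eq_of_lt (Fin.isLt _), add_zero]

theorem exists_eq_code (k b : ℕ) (x : ℕ) : ∃ (c : Cell k b) (v : ℕ), x = code c v := by
  refine ⟨cell k b x, x / numCells k b, ?_⟩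
  rw [code, cell, Equiv.apply_symm_apply, Nat.div_add_mod]

theorem code_inj {c c' : Cell k b} {v v' : ℕ} : code c v = code c' v' ↔ c = c' ∧ v = v' := by
  refine ⟨fun h => ⟨?_, ?_⟩, by rintro ⟨rfl, rfl⟩; rfl⟩
  · rw [← cell_code c v, h, cell_code]
  · rw [← code_div c v, h, code_div]

theorem cell_mod (x : ℕ) : cell k b (x % (numCells k b * (b + 1))) = cell k b x := by
  simp only [cell, Nat.mod_mul_right_mod]

theorem digit_mod (x : ℕ) : digit k b (x % (numCells k b * (b + 1))) = digit k b x := by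
  rw [digit, digit, Nat.mod_mul_right_div_self, Nat.mod_mod]

/-- Whether the half of the tape that the head moves into is the right one. -/
def entersRight : Dir → Bool
  | .left => false
  | .right => true

variable (M : TM0.Machine (Fin (b + 1)) (Fin (k + 1)))

/-- Whether the last digit of the half-tape has to be dropped in the current number, and in the
next number for the same half-tape, before the half-tapes are compared. -/
def mode (c : Cell k b) : Bool × Bool :=
  match M c.2.1 c.2.2 with
  | some (_, .move d) => if entersRight d = c.1 then (true, false) else (false, true)
  | _ => (false, false)

/-- The divisor that drops the cell from a number and, if asked for, the last digit, too. -/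
def divisor (k b : ℕ) : Bool → ℕ
  | false => numCells k b
  | true => numCells k b * (b + 1)

/-- The conditions on consecutive numbers `x`, `y`, `z` of a history that concern the cells and
the last digits only. If `x` and `z` are for right halves, then `y` belongs to the same configuration
as `x`; otherwise it belongs to that of `z`. -/
def Consistent (x y z : ℕ) : Prop :=
  ∃ q s, M (cell k b x).2.1 (cell k b x).2.2 = some (q, s) ∧ (cell k b z).1 = (cell k b x).1 ∧
    (cell k b z).2.1 = q ∧
    cell k b y = (!(cell k b x).1, if (cell k b x).1 then (cell k b x).2 else (cell k b z).2) ∧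
    match s with
    | .write a => (cell k b z).2.2 = a
    | .move d => if entersRight d = (cell k b x).1 then digit k b x = (cell k b z).2.2
        else digit k b z = (cell k b x).2.2

/-- Three consecutive numbers of a history fit together: they are consistent, and the half-tapes
of `x` and `z` are the same up to the digit that is moved. -/
def Fits (x y z : ℕ) : Prop :=
  Consistent M x y z ∧
    x / divisor k b (mode M (cell k b x)).1 = z / divisor k b (mode M (cell k b x)).2

/-- The test for windows of a history that do not fit. -/
noncomputable def test : WindowTest (Bool × Bool) (Fin (numCells k b * (b + 1))) where
  zero := ⟨0, Nat.mul_pos numCells_pos b.succ_pos⟩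
  next r := ⟨(r + 1) % (numCells k b * (b + 1)),
    Nat.mod_lt _ (Nat.mul_pos numCells_pos b.succ_pos)⟩
  inc i r := decide (divisor k b i.1 ∣ r + 1)
  dec i r := decide (divisor k b i.2 ∣ r + 1)
  bad i r s t same := i = mode M (cell k b r) ∧ ¬ (Consistent M r s t ∧ same)
  terminal r := (cell k b r).1 = false ∧ M (cell k b r).2.1 (cell k b r).2.2 = none

theorem test_bad_iff (i : Bool × Bool) (r s t : Fin (numCells k b * (b + 1))) (same : Prop) :
    (test M).bad i r s t same ↔ i = mode M (cell k b r) ∧ ¬ (Consistent M r s t ∧ same) :=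
  Iff.rfl

theorem residue_test (x : ℕ) :
    ((test M).residue x : ℕ) = x % (numCells k b * (b + 1)) := by
  induction x with
  | zero => simp [WindowTest.residue, test]
  | succ x ih =>
    rw [WindowTest.residue, Function.iterate_succ_apply']
    change ((((test M).residue x : ℕ) + 1) % _) = _
    rw [ih, Nat.mod_add_mod]

theorem divisor_dvd (i : Bool) : divisor k b i ∣ numCells k b * (b + 1) := by
  cases i
  · exact dvd_mul_right _ _
  · exact dvd_rfl

/-- The count, over `n` consecutive numbers from `x` on, of those that precede a multiple of the
divisor, is a difference of quotients. -/
theorem count_test (i : Bool) (r : Fin (numCells k b * (b + 1))) (x n : ℕ)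
    (h : (r : ℕ) = x % (numCells k b * (b + 1))) :
    (test M).count (fun r => decide (divisor k b i ∣ r + 1)) r n + x / divisor k b i =
      (x + n) / divisor k b i := by
  induction n generalizing r x with
  | zero => simp [WindowTest.count]
  | succ n ih =>
    have ih := ih ((test M).next r) (x + 1) (by
      change ((r : ℕ) + 1) % _ = _
      rw [h, Nat.mod_add_mod])
    -- the divisor divides the modulus, so divisibility by it can be read off the residue
    have hd : divisor k b i ∣ (r : ℕ) + 1 ↔ divisor k b i ∣ x + 1 := by
      rw [h, Nat.dvd_iff_mod_eq_zero, Nat.dvd_iff_mod_eq_zero, Nat.add_mod,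
        Nat.mod_mod_of_dvd _ (divisor_dvd i), ← Nat.add_mod]
    rw [Nat.succ_div] at ih
    rw [WindowTest.count, ← add_assoc, add_right_comm x n 1, ← ih]
    simp only [decide_eq_true_eq, hd]
    ring

theorem rejects_test_iff (x y z : ℕ) : (test M).Rejects x y z ↔ ¬ Fits M x y z := by
  have hc : ∀ i n, (test M).count (fun r => decide (divisor k b i ∣ r + 1)) (test M).zero n =
      n / divisor k b i := fun i n => by
    simpa using count_test M i (test M).zero 0 n (by simp [test])
  have hx : ∀ i, (test M).count ((test M).inc i) (test M).zero x = x / divisor k b i.1 :=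
    fun i => hc i.1 x
  have hz : ∀ i, (test M).count ((test M).dec i) (test M).zero z = z / divisor k b i.2 :=
    fun i => hc i.2 z
  simp only [WindowTest.Rejects, hx, hz, test_bad_iff, exists_eq_left, Fits, Consistent,
    residue_test, cell_mod, digit_mod]

theorem terminal_test_iff (x : ℕ) : (test M).terminal ((test M).residue x) ↔
    (cell k b x).1 = false ∧ M (cell k b x).2.1 (cell k b x).2.2 = none := by
  change (cell k b _).1 = _ ∧ _ ↔ _
  rw [residue_test, cell_mod]

/-- `Fits` in terms of half-tapes: the half that the head enters loses its first symbol, which becomes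
the scanned one, and the other half gains the symbol scanned before. -/
theorem fits_code_iff (p p' : Bool) (q q₁ : Fin (k + 1)) (h h' : Fin (b + 1)) (c : Cell k b)
    (u v w : ℕ) :
    Fits M (code (p, q, h) u) (code c v) (code (p', q₁, h') w) ↔
      ∃ q' s, M q h = some (q', s) ∧ p' = p ∧ q₁ = q' ∧
        c = (!p, if p then (q, h) else (q₁, h')) ∧
        match s with
        | .write a => h' = a ∧ w = u
        | .move d => if entersRight d = p then h' = u % (b + 1) ∧ w = u / (b + 1)
            else w = h + (b + 1) * u := by
  simp only [Fits, Consistent, mode, cell_code, digit, code_div]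
  rcases M q h with _ | ⟨q', d | a⟩
  · simp
  · have hd : ∀ (c : Cell k b) (v : ℕ),
        code c v / (numCells k b * (b + 1)) = v / (b + 1) := fun c v => by
      rw [← Nat.div_div_eq_div_mul, code_div]
    by_cases hp : entersRight d = p
    · simp only [hp, if_true, divisor, code_div, hd]
      grind
    · have e : w % (b + 1) = h ∧ u = w / (b + 1) ↔ w = h + (b + 1) * u := by
        constructor
        · rintro ⟨h1, rfl⟩
          rw [← h1, Nat.mod_add_div]
        · rintro rfl
          rw [Nat.add_mul_mod_self_left, Nat.mod_eq_of_lt h.isLt,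
            Nat.add_mul_div_left _ _ b.succ_pos, Nat.div_eq_of_lt h.isLt, zero_add]
          exact ⟨rfl, rfl⟩
      simp only [hp, if_false, divisor, code_div, hd, Option.some.injEq, Prod.mk.injEq]
      grind
  · simp only [divisor, code_div]
    grind

/-- The number for the right half of the tape of a configuration. -/
noncomputable def rightCode (c : TM0.Cfg (Fin (b + 1)) (Fin (k + 1))) : ℕ :=
  code (true, c.q, c.Tape.head) (ofListBlank c.Tape.right)

/-- The number for the left half of the tape of a configuration. -/
noncomputable def leftCode (c : TM0.Cfg (Fin (b + 1)) (Fin (k + 1))) : ℕ :=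
  code (false, c.q, c.Tape.head) (ofListBlank c.Tape.left)

/-- The two windows that start in the pair of numbers of a configuration determine the next pair: it
belongs to the next configuration. -/
theorem fits_and_fits_iff (c : TM0.Cfg (Fin (b + 1)) (Fin (k + 1))) (x y : ℕ) :
    Fits M (rightCode c) (leftCode c) x ∧ Fits M (leftCode c) x y ↔
      ∃ c', TM0.step M c = some c' ∧ x = rightCode c' ∧ y = leftCode c' := by
  obtain ⟨⟨p₁, q₁, h₁⟩, v₁, rfl⟩ := exists_eq_code k b x
  obtain ⟨⟨p₂, q₂, h₂⟩, v₂, rfl⟩ := exists_eq_code k b y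
  obtain ⟨q, h, L, R⟩ := c
  simp only [rightCode, leftCode, fits_code_iff, TM0.step, code_inj]
  rcases M q h with _ | ⟨q', ⟨_ | _⟩ | a⟩
  · simp
  · simp [entersRight, Tape.move, ofListBlank_mod, ofListBlank_div, ofListBlank_cons]
    grind
  · simp [entersRight, Tape.move, ofListBlank_mod, ofListBlank_div, ofListBlank_cons]
    grind
  · simp [Tape.write]
    grind

/-- A sequence that starts with the numbers of a configuration is good only if the machine halts
from there: consecutive pairs of numbers are those of successive configurations, and the last number
belongs to a configuration in which the machine stops. -/
theorem eval_dom_of_good (n : ℕ) : ∀ (c : TM0.Cfg (Fin (b + 1)) (Fin (k + 1))) (xs : List ℕ),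
    xs.length ≤ n → (test M).Good (rightCode c :: leftCode c :: xs) →
      (eval (TM0.step M) c).Dom := by
  induction n with
  | zero =>
    intro c xs hn hg
    obtain rfl : xs = [] := List.eq_nil_of_length_eq_zero (by omega)
    have h := ((terminal_test_iff M _).1 hg).2
    rw [leftCode, cell_code] at h
    refine Part.dom_iff_mem.2 ⟨c, mem_eval.2 ⟨.refl, ?_⟩⟩
    simp only [TM0.step, h, Option.map_none]
  | succ n ih =>
    intro c xs hn hg
    rcases xs with _ | ⟨x, _ | ⟨y, xs⟩⟩
    · have h := ((terminal_test_iff M _).1 hg).2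
      rw [leftCode, cell_code] at h
      refine Part.dom_iff_mem.2 ⟨c, mem_eval.2 ⟨.refl, ?_⟩⟩
      simp only [TM0.step, h, Option.map_none]
    -- a terminal number is for a left half, so the sequence cannot end after a right half
    · obtain ⟨hf, hg⟩ := hg
      have h := ((terminal_test_iff M _).1 hg).1
      rw [rejects_test_iff, not_not] at hf
      obtain ⟨-, -, -, h', -⟩ := hf.1
      rw [rightCode, cell_code, h] at h'
      exact absurd h' Bool.false_ne_true
    · obtain ⟨hf, hf', hg⟩ := hg
      rw [rejects_test_iff, not_not] at hf hf'
      obtain ⟨c', hc, rfl, rfl⟩ := (fits_and_fits_iff M c x y).1 ⟨hf, hf'⟩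
      rw [reaches_eval (.single hc)]
      exact ih c' xs (by simp only [List.length_cons] at hn; omega) hg

/-- The numbers of the configurations of a halting computation form a good sequence. -/
theorem exists_good_of_reaches {c c' : TM0.Cfg (Fin (b + 1)) (Fin (k + 1))}
    (h : Reaches (TM0.step M) c c') (h' : TM0.step M c' = none) :
    ∃ xs, (test M).Good (rightCode c :: leftCode c :: xs) := by
  induction h using Relation.ReflTransGen.head_induction_on with
  | refl =>
    refine ⟨[], (terminal_test_iff M _).2 ?_⟩
    rw [leftCode, cell_code]
    exact ⟨rfl, by simpa [TM0.step] using h'⟩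
  | @head c₁ c₂ hs _ ih =>
    obtain ⟨xs, hg⟩ := ih
    obtain ⟨hf, hf'⟩ := (fits_and_fits_iff M c₁ _ _).2 ⟨c₂, hs, rfl, rfl⟩
    refine ⟨rightCode c₂ :: leftCode c₂ :: xs, ?_, ?_, hg⟩
    · rw [rejects_test_iff, not_not]
      exact hf
    · rw [rejects_test_iff, not_not]
      exact hf'

theorem exists_good_iff (c : TM0.Cfg (Fin (b + 1)) (Fin (k + 1))) :
    (∃ xs, (test M).Good ([rightCode c, leftCode c] ++ xs)) ↔ (eval (TM0.step M) c).Dom := by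
  constructor
  · rintro ⟨xs, h⟩
    exact eval_dom_of_good M xs.length c xs le_rfl h
  · intro h
    obtain ⟨c', hc'⟩ := Part.dom_iff_mem.1 h
    obtain ⟨h1, h2⟩ := mem_eval.1 hc'
    exact exists_good_of_reaches M h1 h2

end TapeCode

/-! ### A Turing machine with an undecidable halting problem -/

theorem exists_equiv_fin_apply_eq_zero {A : Type*} [Finite A] (a : A) :
    ∃ (n : ℕ) (e : A ≃ Fin (n + 1)), e a = 0 := by
  obtain ⟨m, ⟨e⟩⟩ := Finite.exists_equiv_fin A
  rcases m with _ | n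
  · exact (e a).elim0
  · exact ⟨n, e.trans (Equiv.swap (e a) 0), by simp⟩

/-- A Turing machine over a finite alphabet that is supported by a finite set of states can be
simulated by one whose symbols and states are numbers. -/
theorem Turing.TM0.Machine.exists_fin {Γ Λ : Type*} [Inhabited Γ] [Inhabited Λ] [Finite Γ]
    (M : TM0.Machine Γ Λ) (S : Finset Λ) (hS : TM0.Supports M S) :
    ∃ (k b : ℕ) (M' : TM0.Machine (Fin (b + 1)) (Fin (k + 1))) (f : Γ → Fin (b + 1)),
      ∀ l : List Γ, (StateTransition.eval (TM0.step M') (TM0.init (l.map f))).Dom ↔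
        (StateTransition.eval (TM0.step M) (TM0.init l)).Dom := by
  classical
  obtain ⟨b, e, he⟩ := exists_equiv_fin_apply_eq_zero (default : Γ)
  obtain ⟨k, g, hg⟩ := exists_equiv_fin_apply_eq_zero (⟨default, hS.1⟩ : S)
  let f₁ : PointedMap Γ (Fin (b + 1)) := ⟨e, he⟩
  let f₂ : PointedMap (Fin (b + 1)) Γ := ⟨e.symm, by rw [Equiv.symm_apply_eq, he]; rfl⟩
  let g₁ : PointedMap Λ (Fin (k + 1)) :=
    ⟨fun q => if hq : q ∈ S then g ⟨q, hq⟩ else 0, by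
      have : (default : Λ) ∈ S := hS.1
      simp only [this, dif_pos, hg]
      rfl⟩
  let g₂ : Fin (k + 1) → Λ := fun i => (g.symm i : Λ)
  refine ⟨k, b, M.map f₁ f₂ g₁ g₂, e, fun l => ?_⟩
  refine StateTransition.tr_eval_dom
    (TM0.Machine.map_respects M f₁ f₂ g₁ g₂ hS (fun x => e.symm_apply_apply x) ?_)
    ⟨hS.1, TM0.map_init f₁ g₁ l⟩
  intro q hq
  have hq : q ∈ S := hq
  change ((g.symm (if hq : q ∈ S then g ⟨q, hq⟩ else 0) : S) : Λ) = q
  rw [dif_pos hq, Equiv.symm_apply_apply]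

/-- A code that halts, on the input `[n]`, just if the `n`th partial recursive function halts
at `0`. -/
theorem exists_code_undecidable : ∃ c : Turing.ToPartrec.Code,
    ¬ ComputablePred fun n : ℕ => (c.eval [n]).Dom := by
  have hf : Partrec fun n : ℕ => (Denumerable.ofNat Nat.Partrec.Code n).eval 0 :=
    Nat.Partrec.Code.eval_part.comp (Computable.ofNat _) (Computable.const 0)
  obtain ⟨c, hc⟩ := Turing.ToPartrec.Code.exists_code (Nat.Partrec'.part_iff₁.2 hf)
  refine ⟨c, fun h => ComputablePred.halting_problem 0 ?_⟩
  have h2 : ∀ n : ℕ, (c.eval [n]).Dom ↔ ((Denumerable.ofNat Nat.Partrec.Code n).eval 0).Dom := by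
    intro n
    have := hc ⟨[n], rfl⟩
    simp only at this
    rw [this]
    rfl
  simp only [h2] at h
  have h3 : (fun c : Nat.Partrec.Code => (c.eval 0).Dom) ≤₀
      fun n : ℕ => ((Denumerable.ofNat Nat.Partrec.Code n).eval 0).Dom :=
    ⟨Encodable.encode, Computable.encode, fun c => by simp only [Denumerable.ofNat_encode]⟩
  exact ComputablePred.computable_of_manyOneReducible h3 h

theorem Turing.PartrecToTM2.trNat_eq_map_bits (n : ℕ) :
    trNat n = n.bits.map fun d => cond d Γ'.bit1 Γ'.bit0 := by
  induction n using Nat.binaryRec' with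
  | zero => simp
  | bit d n h ih =>
    rw [Nat.bits_append_bit n d h, List.map_cons, ← ih, trNat, trNat, ← Num.ofNat'_eq,
      ← Num.ofNat'_eq, Num.ofNat'_bit]
    rcases hm : Num.ofNat' n with _ | m
    · have hn : n = 0 := by
        have := Num.to_of_nat n
        rw [← Num.ofNat'_eq, hm] at this
        exact this.symm
      rw [h hn]
      rfl
    · cases d <;> rfl

theorem primrec_bits : Primrec Nat.bits := by
  have h : Primrec₂ fun (_ : Unit) (n : ℕ) => Nat.bits n := by
    -- the list consists of the expansions of all smaller numbers, and its length is the number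
    refine Primrec.nat_strong_rec _ (g := fun _ (l : List (List Bool)) =>
      if l.length = 0 then some [] else
        (l[l.length / 2]?).map fun r => (l.length).bodd :: r) ?_ ?_
    · have hl : Primrec fun y : Unit × List (List Bool) => y.2.length :=
        Primrec.list_length.comp Primrec.snd
      refine Primrec.ite (Primrec.eq.comp hl (Primrec.const 0)) (Primrec.const _) ?_
      refine Primrec.option_map ?_ ?_
      · exact Primrec.list_getElem?.comp Primrec.snd
          (Primrec.nat_div.comp hl (Primrec.const 2))
      · exact Primrec.list_cons.comp (Primrec.nat_bodd.comp (hl.comp Primrec.fst)) Primrec.snd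
    · intro _ n
      rcases eq_or_ne n 0 with rfl | hn
      · simp
      · have hb : n.bits = n.bodd :: (n / 2).bits := by
          conv_lhs => rw [← Nat.bit_bodd_div2 n]
          rw [Nat.bits_append_bit, Nat.div2_val]
          intro h0
          cases hd : n.bodd
          · have := Nat.bit_bodd_div2 n
            rw [hd, h0] at this
            exact absurd this.symm hn
          · rfl
        have hlt : n / 2 < n := Nat.div_lt_self (Nat.pos_of_ne_zero hn) (by norm_num)
        simp [hn, hb, hlt]
  exact h.comp (Primrec.const ()) Primrec.id

instance : Finite Turing.PartrecToTM2.K' :=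
  Finite.of_injective (β := Fin 4) (fun k => match k with
    | .main => 0
    | .rev => 1
    | .aux => 2
    | .stack => 3) (by intro k k' h; cases k <;> cases k' <;> simp_all)

open Turing in
/-- A fixed Turing machine whose halting on inputs `h :: l n` is undecidable, obtained from a code by
the translations to stack machines, and from these to Turing machines. -/
theorem exists_machine_undecidable :
    ∃ (k b : ℕ) (M : TM0.Machine (Fin (b + 1)) (Fin (k + 1))) (h : Fin (b + 1))
      (l : ℕ → List (Fin (b + 1))), Primrec l ∧
        ¬ ComputablePred fun n => (StateTransition.eval (TM0.step M) (TM0.init (h :: l n))).Dom := by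
  classical
  obtain ⟨c, hc⟩ := exists_code_undecidable
  let _ : Inhabited PartrecToTM2.Λ' := ⟨PartrecToTM2.trNormal c .halt⟩
  let M₁ := TM2to1.tr PartrecToTM2.tr
  have : Finite (TM2to1.Γ' PartrecToTM2.K' fun _ => PartrecToTM2.Γ') :=
    inferInstanceAs (Finite (Bool × _))
  have hS := TM1to0.tr_supports M₁
    (TM2to1.tr_supports PartrecToTM2.tr (PartrecToTM2.tr_supports c .halt))
  obtain ⟨k, b, M, f, hM⟩ := TM0.Machine.exists_fin _ _ hS
  -- the symbol on the tape that represents a symbol on the main stack, the other stacks being lower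
  let g : PartrecToTM2.Γ' → TM2to1.Γ' PartrecToTM2.K' fun _ => PartrecToTM2.Γ' := fun a =>
    (false, Function.update (fun _ => none) .main (some a))
  have key : ∀ n, (StateTransition.eval (TM0.step M) (TM0.init
      ((TM2to1.trInit PartrecToTM2.K'.main (PartrecToTM2.trList [n])).map f))).Dom ↔
        (c.eval [n]).Dom := by
    intro n
    rw [hM]
    change (TM0.eval (TM1to0.tr M₁) _).Dom ↔ _
    rw [TM1to0.tr_eval]
    refine (TM2to1.tr_eval_dom PartrecToTM2.tr _ _).trans ?_
    change (StateTransition.eval (TM2.step PartrecToTM2.tr) _).Dom ↔ _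
    have : (TM2.init PartrecToTM2.K'.main (PartrecToTM2.trList [n]) : TM2.Cfg _ _ _) =
        PartrecToTM2.init c [n] := by
      simp only [TM2.init, PartrecToTM2.init]
      congr 1
      funext k
      cases k <;> rfl
    rw [this, PartrecToTM2.tr_eval]
    rfl
  have hl : ∀ n, (TM2to1.trInit PartrecToTM2.K'.main (PartrecToTM2.trList [n])).map f =
      f (true, (g .cons).2) :: (n.bits.map fun d => f (g (cond d .bit1 .bit0))).reverse := by
    intro n
    have : (PartrecToTM2.trList [n]).reverse =
        .cons :: (n.bits.map fun d => cond d PartrecToTM2.Γ'.bit1 .bit0).reverse := by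
      simp [PartrecToTM2.trNat_eq_map_bits]
    change List.map f ((true, (List.map g (PartrecToTM2.trList [n]).reverse).headI.2) ::
      (List.map g (PartrecToTM2.trList [n]).reverse).tail) = _
    rw [this, List.map_cons]
    change f (true, (g .cons).2) :: List.map f (List.map g _) = _
    rw [← List.map_reverse, ← List.map_reverse, List.map_map, List.map_map]
    rfl
  refine ⟨k, b, M, f (true, (g .cons).2),
    fun n => (n.bits.map fun d => f (g (cond d .bit1 .bit0))).reverse, ?_, ?_⟩
  · exact Primrec.list_reverse.comp (Primrec.list_map primrec_bits
      ((Primrec.dom_finite fun d => f (g (cond d .bit1 .bit0))).comp Primrec.snd))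
  · refine fun h => hc (h.of_eq fun n => ?_)
    rw [← key, hl]

/-! ### Undecidability -/

/-- A computable family of instances of a problem that is decidable on instances satisfying `P`. -/
theorem DecidableGiven.computablePred {X : Type} [Primcodable X] {P p : X → Prop}
    (h : DecidableGiven P p) {F : ℕ → X} (hF : Computable F) (hP : ∀ n, P (F n)) :
    ComputablePred fun n => p (F n) := by
  obtain ⟨f, hf, hfp⟩ := h
  choose g hg hgp using fun n => hfp (F n) (hP n)
  refine ComputablePred.computable_iff.2 ⟨g, Partrec.of_eq_tot (hf.comp hF) hg, ?_⟩
  funext n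
  exact propext (hgp n).symm

theorem primrec_ofDigits (b : ℕ) :
    Primrec fun l : List (Fin (b + 1)) => Nat.ofDigits (b + 1) (l.map Fin.val) := by
  have h : Primrec fun l : List (Fin (b + 1)) => l.foldr (fun a v => a.val + (b + 1) * v) 0 :=
    Primrec.list_foldr Primrec.id (Primrec.const 0)
      (Primrec.nat_add.comp (Primrec.fin_val.comp (Primrec.fst.comp Primrec.snd))
        (Primrec.nat_mul.comp (Primrec.const (b + 1)) (Primrec.snd.comp Primrec.snd))).to₂
  refine h.of_eq fun l => ?_
  induction l with
  | nil => rfl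
  | cons a l ih => rw [List.foldr_cons, ih, List.map_cons, Nat.ofDigits_cons]

open Turing TapeCode in
/-- A computable family of counter machines whose universality cannot be decided: the `n`th machine
accepts the words that do not encode a halting computation of a fixed Turing machine on the
`n`th input. -/
theorem exists_family_undecidable : ∃ F : ℕ → CounterMachine 1 Letter, Computable F ∧
    (∀ n, IsNCM 1 1 (F n)) ∧ ¬ ComputablePred fun n => ∀ w : List Letter, w ∈ (F n).language := by
  obtain ⟨k, b, M, h, l, hl, hM⟩ := exists_machine_undecidable
  obtain ⟨K, ⟨e⟩⟩ :=
    Finite.exists_equiv_fin (WindowTest.State (Bool × Bool) (Fin (numCells k b * (b + 1))))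
  let c : ℕ → TM0.Cfg (Fin (b + 1)) (Fin (k + 1)) := fun n => TM0.init (h :: l n)
  refine ⟨fun n => (test M).machine e (.b :: unaryWord [rightCode (c n), leftCode (c n)]), ?_,
    fun n => (test M).isNCM_machine e _, fun hU => hM (ComputablePred.of_eq hU.not fun n => ?_)⟩
  · have hr : Primrec fun n => rightCode (c n) :=
      Primrec.nat_add.comp (Primrec.nat_mul.comp (Primrec.const (numCells k b))
        ((primrec_ofDigits b).comp hl))
        (Primrec.const (Fintype.equivFin (Cell k b) (true, 0, h) : ℕ))
    exact ((WindowTest.primrec_machine _ e).comp (Primrec.list_cons.comp (Primrec.const _)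
      (primrec_unaryWord.comp (Primrec.list_cons.comp hr (Primrec.const [leftCode (c 0)]))))).to_comp
  · rw [WindowTest.machine_universal_iff, ← exists_good_iff M (c n)]
    push Not
    rfl

/-! ### The shuffle of `a*` and `b*` -/

/-- The automaton with one state, start and final, that has a loop on `x`. -/
def FiniteAutomaton.loop (x : Letter) : FiniteAutomaton Letter := ⟨1, 0, [0], [(0, x, 0)]⟩

theorem Language.mem_kstar_singleton_iff {α : Type*} (x : α) (w : List α) :
    w ∈ ({[x]} : Language α)∗ ↔ ∀ y ∈ w, y = x := by
  rw [Language.mem_kstar]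
  constructor
  · rintro ⟨L, rfl, hL⟩ y hy
    obtain ⟨v, hv, hy⟩ := List.mem_flatten.1 hy
    obtain rfl : v = [x] := hL v hv
    simpa using hy
  · intro h
    refine ⟨w.map fun y => [y], by simp [← List.flatMap_def], ?_⟩
    simp only [List.mem_map]
    rintro _ ⟨y, hy, rfl⟩
    rw [h y hy]
    rfl

theorem FiniteAutomaton.isDFA_loop (x : Letter) : (loop x).IsDFA where
  start_lt := Nat.one_pos
  final_lt q hq := by
    obtain rfl : q = 0 := by simpa [loop] using hq
    exact Nat.one_pos
  trans_lt t ht := by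
    obtain rfl : t = (0, x, 0) := by simpa [loop] using ht
    exact ⟨Nat.one_pos, Nat.one_pos⟩
  deterministic q y p p' h h' := by
    simp only [loop, List.mem_singleton, Prod.mk.injEq] at h h'
    rw [h.2.2, h'.2.2]

theorem FiniteAutomaton.language_loop (x : Letter) :
    (loop x).language = ({[x]} : Language Letter)∗ := by
  have h0 : ∀ q : Fin (loop x).numStates, (q : ℕ) = 0 := fun q => Nat.lt_one_iff.1 q.isLt
  have hs : ∀ (p q : Fin (loop x).numStates) (y : Letter), q ∈ (loop x).toNFA.step p y ↔ y = x := by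
    intro p q y
    change ((p : ℕ), y, (q : ℕ)) ∈ [(0, x, 0)] ↔ _
    simp [h0]
  have key : ∀ (w : List Letter) (q : Fin (loop x).numStates),
      q ∈ (loop x).toNFA.evalFrom (loop x).toNFA.start w ↔ ∀ y ∈ w, y = x := by
    intro w
    induction w using List.reverseRecOn with
    | nil => intro q; exact ⟨fun _ => by simp, fun _ => h0 q⟩
    | append_singleton w y ih =>
      intro q
      rw [NFA.evalFrom_append, NFA.evalFrom_singleton, NFA.mem_stepSet]
      simp only [hs, ih, List.forall_mem_append, List.forall_mem_singleton]
      exact ⟨fun ⟨_, h⟩ => h, fun h => ⟨q, h⟩⟩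
  ext w
  rw [Language.mem_kstar_singleton_iff, language, NFA.mem_accepts]
  constructor
  · rintro ⟨q, -, hq⟩
    exact (key w q).1 hq
  · intro h
    exact ⟨⟨0, Nat.one_pos⟩, List.mem_singleton.2 rfl, (key w _).2 h⟩

/-- Every word is a shuffle of its letters `a` with its letters `b`. -/
theorem mem_kstar_shuffle_kstar (w : List Letter) :
    w ∈ ({[Letter.a]} : Language Letter)∗ ⧢ ({[Letter.b]} : Language Letter)∗ := by
  induction w with
  | nil =>
    exact ⟨[], (Language.mem_kstar_singleton_iff _ _).2 (by simp), [],
      (Language.mem_kstar_singleton_iff _ _).2 (by simp), [], rfl, rfl, rfl⟩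
  | cons x w ih =>
    obtain ⟨u, hu, v, hv, l, hul, hvl, hwl⟩ := ih
    rw [Language.mem_kstar_singleton_iff] at hu hv
    cases x with
    | a =>
      exact ⟨.a :: u, (Language.mem_kstar_singleton_iff _ _).2 (by simpa using hu), v,
        (Language.mem_kstar_singleton_iff _ _).2 hv, ([.a], []) :: l, by simp [hul], by simp [hvl],
        by simp [hwl]⟩
    | b =>
      exact ⟨u, (Language.mem_kstar_singleton_iff _ _).2 hu, .b :: v,
        (Language.mem_kstar_singleton_iff _ _).2 (by simpa using hv), ([], [.b]) :: l,
        by simp [hul], by simp [hvl], by simp [hwl]⟩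

theorem shuffle_le_iff_universal {M₁ M₂ : FiniteAutomaton Letter} {M₃ : CounterMachine 1 Letter}
    (h : IsShuffleInstance (M₁, M₂, M₃)) :
    M₁.language ⧢ M₂.language ≤ M₃.language ↔ ∀ w : List Letter, w ∈ M₃.language := by
  obtain ⟨⟨-, -, h₁⟩, ⟨-, -, h₂⟩, -⟩ := h
  simp only at h₁ h₂
  rw [h₁, h₂]
  exact ⟨fun hle w => hle (mem_kstar_shuffle_kstar w), fun hU w _ => hU w⟩

theorem mainTheorem7 :
    -- inclusion of the shuffle is undecidable
    (¬ DecidableGiven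
      (X := FiniteAutomaton Letter × FiniteAutomaton Letter × CounterMachine 1 Letter)
      IsShuffleInstance
      (fun x => x.1.language ⧢ x.2.1.language ≤ x.2.2.language)) ∧
    -- it is the same question as universality of the `NCM(1, 1)`
    (∀ (M₁ M₂ : FiniteAutomaton Letter) (M₃ : CounterMachine 1 Letter),
      IsShuffleInstance (M₁, M₂, M₃) →
        (M₁.language ⧢ M₂.language ≤ M₃.language ↔ ∀ w : List Letter, w ∈ M₃.language)) ∧
    -- universality is undecidable
    (¬ DecidableGiven (X := CounterMachine 1 Letter) (IsNCM 1 1)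
      (fun M => ∀ w : List Letter, w ∈ M.language)) := by
  obtain ⟨F, hF, hNCM, hU⟩ := exists_family_undecidable
  have hI : ∀ n, IsShuffleInstance
      (FiniteAutomaton.loop .a, FiniteAutomaton.loop .b, F n) := fun n =>
    ⟨⟨FiniteAutomaton.isDFA_loop _, rfl, FiniteAutomaton.language_loop _⟩,
      ⟨FiniteAutomaton.isDFA_loop _, rfl, FiniteAutomaton.language_loop _⟩, hNCM n⟩
  refine ⟨fun h => hU ?_, fun M₁ M₂ M₃ h => shuffle_le_iff_universal h, fun h => hU ?_⟩
  · refine (h.computablePred (F := fun n => (FiniteAutomaton.loop .a, FiniteAutomaton.loop .b, F n))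
      ((Computable.const _).pair ((Computable.const _).pair hF)) hI).of_eq fun n => ?_
    exact shuffle_le_iff_universal (hI n)
  · exact h.computablePred hF hNCM
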